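/- Let $L$ be the language with function symbols $0,+,-$, a unary symbol $r\cdot{-}$ for each $r\in\mathbb R$, unary symbols $\sigma,\sigma^{-1}$, and one relation symbol $<$ (besides equality). Let $\mathbb R\text{-}\mathsf{OVSA}$ be the $L$-theory of (possibly trivial) linearly ordered $\mathbb R$-vector spaces with an automorphism $\sigma$ of ordered $\mathbb R$-vector spaces and its inverse $\sigma^{-1}$. Positive formulas are those built from atomic formulas using $\wedge,\vee,\top,\bot,\exists$. A model $M$ of a theory $T$ is positively existentially closed (pec) if every homomorphism $g\colon M\to A$ into a model $A$ of $T$ is an immersion, that is, for every positive formula $\varphi(x)$ and every tuple $a$ from $M$, $A\models\varphi(g(a))$ implies $M\models\varphi(a)$. Theorem. Let $M$ be a pec model of $\mathbb R\text{-}\mathsf{OVSA}$, let $f=\sum_i r_i\sigma^i\in\mathbb R[\sigma]$ be a polynomial, and denote also by $f$ the map $M\to M$, $x\mapsto\sum_i r_i\cdot\sigma^i(x)$. Then $f\colon M\to M$ has the Intermediate Value Property: for all $a\le b$ in $M$ and every $d\in M$ lying between $f(a)$ and $f(b)$ (inclusive, in either order) there is $c\in M$ with $a\le c\le b$ and $f(c)=d$.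 If moreover $f\ne 0$, then $f\colon M\to M$ is surjective. -/

import Mathlib

open FirstOrder FirstOrder.Language
open scoped Polynomial

universe u v w

/-! ### Positive logic -/

/-- Positive formulas: built from atomic formulas (equalities and relations between terms)
with `⊥`, `⊤`, `∧`, `∨` and `∃`. -/
inductive IsPositive {L : FirstOrder.Language.{u, v}} {α : Type*} : ∀ {n : ℕ}, L.BoundedFormula α n → Prop
  | falsum {n : ℕ} : IsPositive (⊥ : L.BoundedFormula α n)
  | verum {n : ℕ} : IsPositive (⊤ : L.BoundedFormula α n)
  | equal {n : ℕ} (t₁ t₂ : L.Term (α ⊕ Fin n)) : IsPositive (BoundedFormula.equal t₁ t₂)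
  | rel {n l : ℕ} (R : L.Relations l) (ts : Fin l → L.Term (α ⊕ Fin n)) :
      IsPositive (BoundedFormula.rel R ts)
  | inf {n : ℕ} {φ ψ : L.BoundedFormula α n} :
      IsPositive φ → IsPositive ψ → IsPositive (φ ⊓ ψ)
  | sup {n : ℕ} {φ ψ : L.BoundedFormula α n} :
      IsPositive φ → IsPositive ψ → IsPositive (φ ⊔ ψ)
  | ex {n : ℕ} {φ : L.BoundedFormula α (n + 1)} : IsPositive φ → IsPositive φ.ex

/-- A homomorphism is an immersion if it reflects all positive formulas
(every homomorphism preserves them). -/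
def IsImmersion {L : FirstOrder.Language.{u, v}} {M A : Type*} [L.Structure M] [L.Structure A]
    (g : M →[L] A) : Prop :=
  ∀ (n : ℕ) (φ : L.Formula (Fin n)), IsPositive φ →
    ∀ a : Fin n → M, φ.Realize (g ∘ a) → φ.Realize a

/-- `M` is a positively existentially closed (pec) model of `T`: it is a model of `T`, and every
homomorphism from `M` to a model of `T` is an immersion. (By downward Löwenheim–Skolem it is enough
to consider models in a universe that contains `M` and the language.) -/
def IsPec {L : FirstOrder.Language.{u, v}} (T : L.Theory) (M : Type w) [L.Structure M] : Prop :=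
  M ⊨ T ∧ ∀ (A : Type (max u v w)) [L.Structure A], A ⊨ T → ∀ g : M →[L] A, IsImmersion g

/-! ### Ordered vector spaces with an automorphism -/

/-- Function symbols `0`, `+`, `-`, `r • ·` for each scalar `r`, `σ` and `σ⁻¹`. -/
inductive OVSAFunc (R : Type u) : ℕ → Type u
  | zero : OVSAFunc R 0
  | add : OVSAFunc R 2
  | neg : OVSAFunc R 1
  | smul (r : R) : OVSAFunc R 1
  | sigma : OVSAFunc R 1
  | sigmaInv : OVSAFunc R 1

/-- The only relation symbol (besides equality) is `<`. -/
inductive OVSARel : ℕ → Type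
  | lt : OVSARel 2

/-- The language of ordered `R`-vector spaces with an automorphism. -/
def ovsaLang (R : Type u) : FirstOrder.Language.{u, 0} where
  Functions := OVSAFunc R
  Relations := OVSARel

namespace OVSA

section Terms

variable {R : Type u} {α : Type*}

/-- The term `0`. -/
def zeroT : (ovsaLang R).Term α := Term.func (L := ovsaLang R) OVSAFunc.zero ![]

/-- The term `t + s`. -/
def addT (t s : (ovsaLang R).Term α) : (ovsaLang R).Term α :=
  Term.func (L := ovsaLang R) OVSAFunc.add ![t, s]

/-- The term `-t`. -/
def negT (t : (ovsaLang R).Term α) : (ovsaLang R).Term α :=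
  Term.func (L := ovsaLang R) OVSAFunc.neg ![t]

/-- The term `r • t`. -/
def smulT (r : R) (t : (ovsaLang R).Term α) : (ovsaLang R).Term α :=
  Term.func (L := ovsaLang R) (OVSAFunc.smul r) ![t]

/-- The term `σ t`. -/
def sigmaT (t : (ovsaLang R).Term α) : (ovsaLang R).Term α :=
  Term.func (L := ovsaLang R) OVSAFunc.sigma ![t]

/-- The term `σ⁻¹ t`. -/
def sigmaInvT (t : (ovsaLang R).Term α) : (ovsaLang R).Term α :=
  Term.func (L := ovsaLang R) OVSAFunc.sigmaInv ![t]

/-- The formula `t < s`. -/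
def ltF {n : ℕ} (t s : (ovsaLang R).Term (α ⊕ Fin n)) : (ovsaLang R).BoundedFormula α n :=
  BoundedFormula.rel (L := ovsaLang R) OVSARel.lt ![t, s]

end Terms

/-- Names of the axioms of `R`-OVSA. -/
inductive Ax (R : Type u) [Field R] [LinearOrder R] : Type u
  | addAssoc | addComm | addZero | addNeg
  | ltIrrefl | ltTrans | ltTotal | addLt
  | smulAdd (r : R) | addSMul (r s : R) | mulSMul (r s : R) | oneSMul
  | smulPos (r : R) (hr : 0 < r)
  | sigmaAdd | sigmaSMul (r : R) | sigmaLt | sigmaSigmaInv | sigmaInvSigma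

/-- The axioms of `R`-OVSA: abelian group, linear order compatible with addition, `R`-vector space,
multiplication by positive scalars preserves positivity, and `σ` is additive, commutes with scalars,
preserves `<`, and has inverse `σ⁻¹`. -/
def Ax.toSentence {R : Type u} [Field R] [LinearOrder R] : Ax R → (ovsaLang R).Sentence
  | .addAssoc => ∀' ∀' ∀' (addT (addT (&0) (&1)) (&2) =' addT (&0) (addT (&1) (&2)))
  | .addComm => ∀' ∀' (addT (&0) (&1) =' addT (&1) (&0))
  | .addZero => ∀' (addT (&0) zeroT =' &0)
  | .addNeg => ∀' (addT (&0) (negT (&0)) =' zeroT)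
  | .ltIrrefl => ∀' (ltF (&0) (&0) ⟹ ⊥)
  | .ltTrans => ∀' ∀' ∀' ((ltF (&0) (&1) ⊓ ltF (&1) (&2)) ⟹ ltF (&0) (&2))
  | .ltTotal => ∀' ∀' (ltF (&0) (&1) ⊔ ((&0 =' &1) ⊔ ltF (&1) (&0)))
  | .addLt => ∀' ∀' ∀' (ltF (&0) (&1) ⟹ ltF (addT (&0) (&2)) (addT (&1) (&2)))
  | .smulAdd r => ∀' ∀' (smulT r (addT (&0) (&1)) =' addT (smulT r (&0)) (smulT r (&1)))
  | .addSMul r s => ∀' (smulT (r + s) (&0) =' addT (smulT r (&0)) (smulT s (&0)))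
  | .mulSMul r s => ∀' (smulT (r * s) (&0) =' smulT r (smulT s (&0)))
  | .oneSMul => ∀' (smulT 1 (&0) =' &0)
  | .smulPos r _ => ∀' (ltF zeroT (&0) ⟹ ltF zeroT (smulT r (&0)))
  | .sigmaAdd => ∀' ∀' (sigmaT (addT (&0) (&1)) =' addT (sigmaT (&0)) (sigmaT (&1)))
  | .sigmaSMul r => ∀' (sigmaT (smulT r (&0)) =' smulT r (sigmaT (&0)))
  | .sigmaLt => ∀' ∀' (ltF (&0) (&1) ⟹ ltF (sigmaT (&0)) (sigmaT (&1)))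
  | .sigmaSigmaInv => ∀' (sigmaT (sigmaInvT (&0)) =' &0)
  | .sigmaInvSigma => ∀' (sigmaInvT (sigmaT (&0)) =' &0)

end OVSA

/-- The theory `R`-OVSA of (possibly trivial) ordered `R`-vector spaces with an automorphism. -/
def ovsaTheory (R : Type u) [Field R] [LinearOrder R] : (ovsaLang R).Theory :=
  Set.range OVSA.Ax.toSentence

/-- The structure on an ordered `R`-vector space `M` given by a linear automorphism `σ`. -/
@[reducible] def ovsaStructure {R : Type u} [Field R] {M : Type w} [AddCommGroup M] [LinearOrder M] [Module R M]
    (σ : M ≃ₗ[R] M) : (ovsaLang R).Structure M where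
  funMap {_} F := match F with
    | OVSAFunc.zero => fun _ => 0
    | OVSAFunc.add => fun x => x 0 + x 1
    | OVSAFunc.neg => fun x => -x 0
    | OVSAFunc.smul r => fun x => r • x 0
    | OVSAFunc.sigma => fun x => σ (x 0)
    | OVSAFunc.sigmaInv => fun x => σ.symm (x 0)
  RelMap {_} P := match P with
    | OVSARel.lt => fun x => x 0 < x 1

namespace OVSA

section Realize

variable {R : Type u} {α : Type*} {M : Type w} [S : (ovsaLang R).Structure M]

theorem realize_zeroT (v : α → M) :
    (zeroT : (ovsaLang R).Term α).realize v = S.funMap (n := 0) OVSAFunc.zero ![] :=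
  congrArg (S.funMap (n := 0) OVSAFunc.zero) (funext fun i => i.elim0)

theorem realize_addT (t s : (ovsaLang R).Term α) (v : α → M) :
    (addT t s).realize v = S.funMap (n := 2) OVSAFunc.add ![t.realize v, s.realize v] :=
  congrArg (S.funMap (n := 2) OVSAFunc.add) (funext fun i => by fin_cases i <;> rfl)

theorem realize_negT (t : (ovsaLang R).Term α) (v : α → M) :
    (negT t).realize v = S.funMap (n := 1) OVSAFunc.neg ![t.realize v] :=
  congrArg (S.funMap (n := 1) OVSAFunc.neg) (funext fun i => by fin_cases i; rfl)

theorem realize_smulT (r : R) (t : (ovsaLang R).Term α) (v : α → M) :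
    (smulT r t).realize v = S.funMap (n := 1) (OVSAFunc.smul r) ![t.realize v] :=
  congrArg (S.funMap (n := 1) (OVSAFunc.smul r)) (funext fun i => by fin_cases i; rfl)

theorem realize_sigmaT (t : (ovsaLang R).Term α) (v : α → M) :
    (sigmaT t).realize v = S.funMap (n := 1) OVSAFunc.sigma ![t.realize v] :=
  congrArg (S.funMap (n := 1) OVSAFunc.sigma) (funext fun i => by fin_cases i; rfl)

theorem realize_sigmaInvT (t : (ovsaLang R).Term α) (v : α → M) :
    (sigmaInvT t).realize v = S.funMap (n := 1) OVSAFunc.sigmaInv ![t.realize v] :=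
  congrArg (S.funMap (n := 1) OVSAFunc.sigmaInv) (funext fun i => by fin_cases i; rfl)

theorem realize_ltF {n : ℕ} (t s : (ovsaLang R).Term (α ⊕ Fin n)) (v : α → M) (x : Fin n → M) :
    (ltF t s).Realize v x ↔
      S.RelMap (n := 2) OVSARel.lt ![t.realize (Sum.elim v x), s.realize (Sum.elim v x)] :=
  iff_of_eq <| congrArg (S.RelMap (n := 2) OVSARel.lt) (funext fun i => by fin_cases i <;> rfl)

/-- Meaning of an axiom, in terms of operations `0`, `+`, `-`, `r • ·`, `σ`, `σ⁻¹` and a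
relation `<`. -/
def Ax.Holds [Field R] [LinearOrder R] (Z : M) (P : M → M → M) (N : M → M) (K : R → M → M)
    (s s' : M → M) (Q : M → M → Prop) : Ax R → Prop
  | .addAssoc => ∀ a b c, P (P a b) c = P a (P b c)
  | .addComm => ∀ a b, P a b = P b a
  | .addZero => ∀ a, P a Z = a
  | .addNeg => ∀ a, P a (N a) = Z
  | .ltIrrefl => ∀ a, ¬ Q a a
  | .ltTrans => ∀ a b c, Q a b ∧ Q b c → Q a c
  | .ltTotal => ∀ a b, Q a b ∨ a = b ∨ Q b a
  | .addLt => ∀ a b c, Q a b → Q (P a c) (P b c)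
  | .smulAdd r => ∀ a b, K r (P a b) = P (K r a) (K r b)
  | .addSMul r q => ∀ a, K (r + q) a = P (K r a) (K q a)
  | .mulSMul r q => ∀ a, K (r * q) a = K r (K q a)
  | .oneSMul => ∀ a, K 1 a = a
  | .smulPos r _ => ∀ a, Q Z a → Q Z (K r a)
  | .sigmaAdd => ∀ a b, s (P a b) = P (s a) (s b)
  | .sigmaSMul r => ∀ a, s (K r a) = K r (s a)
  | .sigmaLt => ∀ a b, Q a b → Q (s a) (s b)
  | .sigmaSigmaInv => ∀ a, s (s' a) = a
  | .sigmaInvSigma => ∀ a, s' (s a) = a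

theorem realize_toSentence [Field R] [LinearOrder R] (a : Ax R) :
    M ⊨ a.toSentence ↔
      a.Holds (S.funMap (n := 0) OVSAFunc.zero ![])
        (fun a b => S.funMap (n := 2) OVSAFunc.add ![a, b])
        (fun a => S.funMap (n := 1) OVSAFunc.neg ![a])
        (fun r a => S.funMap (n := 1) (OVSAFunc.smul r) ![a])
        (fun a => S.funMap (n := 1) OVSAFunc.sigma ![a])
        (fun a => S.funMap (n := 1) OVSAFunc.sigmaInv ![a])
        (fun a b => S.RelMap (n := 2) OVSARel.lt ![a, b]) := by
  cases a <;>
    simp only [Ax.toSentence, Sentence.Realize, Formula.Realize, BoundedFormula.realize_all,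
      BoundedFormula.realize_imp, BoundedFormula.realize_inf, BoundedFormula.realize_sup,
      BoundedFormula.realize_bdEqual, BoundedFormula.realize_bot, realize_ltF,
      realize_addT, realize_zeroT, realize_negT, realize_smulT, realize_sigmaT, realize_sigmaInvT]
  all_goals rfl

end Realize

end OVSA

/-- The structures `ovsaStructure σ` are models of `R`-OVSA. -/
theorem model_ovsaStructure {R : Type u} [Field R] [LinearOrder R] {M : Type w} [AddCommGroup M]
    [LinearOrder M] [IsOrderedAddMonoid M] [Module R M] [IsStrictOrderedModule R M]
    (σ : M ≃ₗ[R] M) (hσ : StrictMono σ) :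
    @Theory.Model (ovsaLang R) M (ovsaStructure σ) (ovsaTheory R) := by
  let S := ovsaStructure σ
  refine Theory.model_iff _ |>.2 ?_
  rintro _ ⟨a, rfl⟩
  refine (OVSA.realize_toSentence a).2 ?_
  cases a with
  | addAssoc => exact fun a b c => add_assoc a b c
  | addComm => exact fun a b => add_comm a b
  | addZero => exact fun a => add_zero a
  | addNeg => exact fun a => add_neg_cancel a
  | ltIrrefl => exact fun a => lt_irrefl a
  | ltTrans => exact fun a b c h => lt_trans h.1 h.2
  | ltTotal => exact fun a b => lt_trichotomy a b
  | addLt => exact fun a b c (h : a < b) => (add_lt_add_left h c : a + c < b + c)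
  | smulAdd r => exact fun a b => smul_add r a b
  | addSMul r s => exact fun a => add_smul r s a
  | mulSMul r s => exact fun a => mul_smul r s a
  | oneSMul => exact fun a => one_smul R a
  | smulPos r hr => exact fun a (h : 0 < a) => smul_pos hr h
  | sigmaAdd => exact fun a b => map_add σ a b
  | sigmaSMul r => exact fun a => map_smul σ r a
  | sigmaLt => exact fun a b h => hσ h
  | sigmaSigmaInv => exact fun a => σ.apply_symm_apply a
  | sigmaInvSigma => exact fun a => σ.symm_apply_apply a

/-- Every model of `R`-OVSA is of the form `ovsaStructure σ`. -/
theorem exists_eq_ovsaStructure {R : Type u} [Field R] [LinearOrder R] [IsStrictOrderedRing R]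
    {M : Type w} [S : (ovsaLang R).Structure M] (hM : M ⊨ ovsaTheory R) :
    ∃ (_ : AddCommGroup M) (_ : LinearOrder M) (_ : IsOrderedAddMonoid M) (_ : Module R M)
      (_ : IsStrictOrderedModule R M) (σ : M ≃ₗ[R] M), StrictMono σ ∧ S = ovsaStructure σ := by
  have key : ∀ a : OVSA.Ax R, _ := fun a =>
    (OVSA.realize_toSentence a).1 (hM.realize_of_mem _ ⟨a, rfl⟩)
  let P : M → M → M := fun a b => S.funMap (n := 2) OVSAFunc.add ![a, b]
  let s : M → M := fun a => S.funMap (n := 1) OVSAFunc.sigma ![a]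
  let Q : M → M → Prop := fun a b => S.RelMap (n := 2) OVSARel.lt ![a, b]
  have ltTrans : ∀ a b c, Q a b ∧ Q b c → Q a c := key .ltTrans
  have ltIrrefl : ∀ a, ¬ Q a a := key .ltIrrefl
  have ltTotal : ∀ a b, Q a b ∨ a = b ∨ Q b a := key .ltTotal
  have addComm : ∀ a b, P a b = P b a := key .addComm
  let i0 : Zero M := ⟨S.funMap (n := 0) OVSAFunc.zero ![]⟩
  let i1 : Add M := ⟨P⟩
  let i2 : Neg M := ⟨fun a => S.funMap (n := 1) OVSAFunc.neg ![a]⟩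
  let i3 : AddCommGroup M :=
    { add_assoc := key .addAssoc
      zero_add := fun a => (addComm 0 a).trans (key .addZero a)
      add_zero := key .addZero
      nsmul := nsmulRec
      zsmul := zsmulRec
      neg_add_cancel := fun a => (addComm (-a) a).trans (key .addNeg a)
      add_comm := addComm }
  let i4 : LinearOrder M :=
    { lt := Q, le := fun a b => Q a b ∨ a = b
      le_refl := fun a => Or.inr rfl
      le_trans := by
        rintro a b c (h | rfl) (h' | rfl)
        exacts [Or.inl (ltTrans _ _ _ ⟨h, h'⟩), Or.inl h, Or.inl h', Or.inr rfl]
      lt_iff_le_not_ge := by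
        intro a b
        refine ⟨fun h => ⟨Or.inl h, ?_⟩, ?_⟩
        · rintro (h' | rfl)
          exacts [ltIrrefl _ (ltTrans _ _ _ ⟨h, h'⟩), ltIrrefl _ h]
        · rintro ⟨h | rfl, h'⟩
          exacts [h, absurd (Or.inr rfl) h']
      le_antisymm := by
        rintro a b (h | rfl) (h' | h')
        exacts [absurd (ltTrans _ _ _ ⟨h, h'⟩) (ltIrrefl _), h'.symm, rfl, rfl]
      le_total := by
        intro a b
        rcases ltTotal a b with h | h | h
        exacts [Or.inl (Or.inl h), Or.inl (Or.inr h), Or.inr (Or.inl h)]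
      toDecidableLE := Classical.decRel _ }
  let i5 : SMul R M := ⟨fun r a => S.funMap (n := 1) (OVSAFunc.smul r) ![a]⟩
  let i6 : Module R M := Module.ofMinimalAxioms (fun r => key (.smulAdd r))
    (fun r q => key (.addSMul r q)) (fun r q => key (.mulSMul r q)) (key .oneSMul)
  have addLt : ∀ a b c : M, a < b → a + c < b + c := key .addLt
  have i7 : IsOrderedAddMonoid M :=
    { add_le_add_left := by
        rintro a b h c
        rcases h.lt_or_eq with h | rfl
        exacts [(addLt a b c h).le, le_rfl] }
  have smulPos : ∀ (r : R) (a : M), 0 < r → 0 < a → 0 < r • a :=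
    fun r a hr h => key (.smulPos r hr) a h
  have i8 : IsStrictOrderedModule R M :=
    { smul_lt_smul_of_pos_left := by
        intro r hr a b h
        have := smulPos r (b - a) hr (sub_pos.2 h)
        rwa [smul_sub, sub_pos] at this
      smul_lt_smul_of_pos_right := by
        intro a ha r q h
        have := smulPos (q - r) a (sub_pos.2 h) ha
        rwa [sub_smul, sub_pos] at this }
  let σ : M ≃ₗ[R] M :=
    { toFun := s
      invFun := fun a => S.funMap (n := 1) OVSAFunc.sigmaInv ![a]
      map_add' := key .sigmaAdd
      map_smul' := fun r => key (.sigmaSMul r)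
      left_inv := key .sigmaInvSigma
      right_inv := key .sigmaSigmaInv }
  refine ⟨i3, i4, i7, i6, i8, σ, fun a b h => key .sigmaLt a b h, ?_⟩
  have e0 (x : Fin 0 → M) : x = ![] := funext fun i => i.elim0
  have e1 (x : Fin 1 → M) : x = ![x 0] := funext fun i => by fin_cases i; rfl
  have e2 (x : Fin 2 → M) : x = ![x 0, x 1] := funext fun i => by fin_cases i <;> rfl
  refine Structure.ext ?_ ?_
  · funext n F x
    cases F with
    | zero => exact congrArg (S.funMap (n := 0) OVSAFunc.zero) (e0 x)
    | add => exact congrArg (S.funMap (n := 2) OVSAFunc.add) (e2 x)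
    | neg => exact congrArg (S.funMap (n := 1) OVSAFunc.neg) (e1 x)
    | smul r => exact congrArg (S.funMap (n := 1) (OVSAFunc.smul r)) (e1 x)
    | sigma => exact congrArg (S.funMap (n := 1) OVSAFunc.sigma) (e1 x)
    | sigmaInv => exact congrArg (S.funMap (n := 1) OVSAFunc.sigmaInv) (e1 x)
  · funext n F x
    cases F with
    | lt => exact congrArg (S.RelMap (n := 2) OVSARel.lt) (e2 x)

/-- The Intermediate Value Property for a self-map of a linear order. -/
def HasIVP {M : Type*} [LinearOrder M] (F : M → M) : Prop :=
  ∀ a b : M, a ≤ b → ∀ d ∈ Set.uIcc (F a) (F b), ∃ c ∈ Set.Icc a b, F c = d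

/-- The map `x ↦ ∑ i, rᵢ • σ^i x` induced by the `σ`-polynomial `∑ i, rᵢ σ^i`. -/
noncomputable def sigmaMap {R : Type u} [Field R] {M : Type w} [AddCommGroup M] [Module R M]
    (σ : M ≃ₗ[R] M) (f : R[X]) (x : M) : M :=
  f.sum fun i r => r • (⇑σ)^[i] x

/-! The map $f\mapsto f(\sigma)$ turns products of polynomials into compositions, and both the IVP
and surjectivity survive composition. So it is enough to treat nonzero constants and the irreducible
polynomials over $\mathbb R$: up to a constant, $\sigma-r$ and $\sigma^2+p\sigma+q$ with $p^2<4q$.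

Since `<` is a symbol of a total order, homomorphisms are strictly monotone; pec-ness pulls
solutions of $f(c)=d$, also with $a\le c\le b$, back along them.

If $f$ is strictly increasing, then $f$ is itself a homomorphism $M\to M$, and pulling back
$f(c)=f(d)$ along it gives $f(c)=d$ (`IsPec.surjective_of_strictMono`); monotone surjections have
the IVP. This covers $\sigma-r$ with $r\le 0$ and, by completeness of $\mathbb R$, the quadratics
(`strictMono_sigmaMap_quadratic`).

If $r>0$, solutions of $\sigma y-ry=d$ are fixed points of the increasing map
$\psi(y)=\sigma^{-1}(ry+d)$. A cut of $M$ preserved by $\psi$ can be filled by a fixed point in an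
extension $M\oplus\mathbb R x$ (`exists_extension_of_isCutFilter`). The cut at $+\infty$ gives
surjectivity; the limit of the iterates of $\psi$ or $\psi^{-1}$ from $a$ gives the IVP. -/

/-! ### Polynomials in σ as linear operators and as terms -/

theorem sigmaMap_eq_aeval {M : Type w} [AddCommGroup M] [Module ℝ M] (σ : M ≃ₗ[ℝ] M)
    (f : ℝ[X]) (x : M) : sigmaMap σ f x = Polynomial.aeval (σ : M →ₗ[ℝ] M) f x := by
  simp only [sigmaMap, Polynomial.aeval_eq_sum_range, Polynomial.sum_over_range, LinearMap.sum_apply,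
    LinearMap.smul_apply, Module.End.pow_apply, zero_smul, implies_true]
  rfl

theorem sigmaMap_mul {M : Type w} [AddCommGroup M] [Module ℝ M] (σ : M ≃ₗ[ℝ] M)
    (f g : ℝ[X]) : sigmaMap σ (f * g) = sigmaMap σ f ∘ sigmaMap σ g := by
  funext x
  simp [sigmaMap_eq_aeval]

theorem sigmaMap_add {M : Type w} [AddCommGroup M] [Module ℝ M] (σ : M ≃ₗ[ℝ] M)
    (f g : ℝ[X]) (x : M) : sigmaMap σ (f + g) x = sigmaMap σ f x + sigmaMap σ g x := by
  simp [sigmaMap_eq_aeval]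

theorem sigmaMap_monomial {M : Type w} [AddCommGroup M] [Module ℝ M] (σ : M ≃ₗ[ℝ] M)
    (n : ℕ) (r : ℝ) (x : M) : sigmaMap σ (Polynomial.monomial n r) x = r • (⇑σ)^[n] x :=
  Polynomial.sum_monomial_index r (fun i r => r • (⇑σ)^[i] x) (zero_smul _ _)

/-- `σ`-polynomials are uniformly given by terms of the language. -/
theorem exists_term_sigmaMap {α : Type*} (f : ℝ[X]) (t : (ovsaLang ℝ).Term α) :
    ∃ s : (ovsaLang ℝ).Term α, ∀ (A : Type u) [AddCommGroup A] [LinearOrder A] [Module ℝ A]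
      (τ : A ≃ₗ[ℝ] A) (v : α → A),
      @Term.realize _ A (ovsaStructure τ) α v s =
        sigmaMap τ f (@Term.realize _ A (ovsaStructure τ) α v t) := by
  induction f using Polynomial.induction_on' with
  | add p q hp hq =>
    obtain ⟨s, hs⟩ := hp
    obtain ⟨s', hs'⟩ := hq
    refine ⟨OVSA.addT s s', fun A _ _ _ τ v => ?_⟩
    let S := ovsaStructure τ
    rw [sigmaMap_add, ← hs, ← hs', OVSA.realize_addT]
    rfl
  | monomial n r =>
    have : ∃ s : (ovsaLang ℝ).Term α, ∀ (A : Type u) [AddCommGroup A] [LinearOrder A] [Module ℝ A]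
        (τ : A ≃ₗ[ℝ] A) (v : α → A), @Term.realize _ A (ovsaStructure τ) α v s =
          (⇑τ)^[n] (@Term.realize _ A (ovsaStructure τ) α v t) := by
      induction n with
      | zero => exact ⟨t, fun A _ _ _ τ v => rfl⟩
      | succ n ih =>
        obtain ⟨s, hs⟩ := ih
        refine ⟨OVSA.sigmaT s, fun A _ _ _ τ v => ?_⟩
        let S := ovsaStructure τ
        rw [Function.iterate_succ_apply', ← hs, OVSA.realize_sigmaT]
        rfl
    obtain ⟨s, hs⟩ := this
    refine ⟨OVSA.smulT r s, fun A _ _ _ τ v => ?_⟩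
    let S := ovsaStructure τ
    rw [sigmaMap_monomial, ← hs, OVSA.realize_smulT]
    rfl

/-- A strictly monotone linear map commuting with the automorphisms is a homomorphism. -/
noncomputable def ovsaHom {M A : Type*} [AddCommGroup M] [LinearOrder M] [Module ℝ M]
    [AddCommGroup A] [LinearOrder A] [Module ℝ A] (σ : M ≃ₗ[ℝ] M) (τ : A ≃ₗ[ℝ] A)
    (g : M →ₗ[ℝ] A) (hg : StrictMono g) (h : ∀ x, g (σ x) = τ (g x)) :
    @Language.Hom (ovsaLang ℝ) M A (ovsaStructure σ) (ovsaStructure τ) :=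
  let _ := ovsaStructure σ
  let _ := ovsaStructure τ
  { toFun := g
    map_fun' := by
      intro n F x
      cases F with
      | zero => exact map_zero g
      | add => exact map_add g _ _
      | neg => exact map_neg g _
      | smul r => exact map_smul g r _
      | sigma => exact h _
      | sigmaInv =>
        refine τ.injective ((h _).symm.trans ?_)
        exact (congrArg g (σ.apply_symm_apply _)).trans (τ.apply_symm_apply _).symm
    map_rel' := by
      intro n P x
      cases P with
      | lt => exact fun h' => hg h' }

/-! ### Transfer of solutions to pec models -/

section Pec

variable {M : Type u} [AddCommGroup M] [LinearOrder M] [Module ℝ M] {σ : M ≃ₗ[ℝ] M}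
  {A : Type u} [AddCommGroup A] [LinearOrder A] [IsOrderedAddMonoid A] [Module ℝ A]
  [IsStrictOrderedModule ℝ A]

/-- Equations `f(c) = d` solvable in an extension are solvable in a pec model. -/
theorem IsPec.exists_sigmaMap_eq (hM : @IsPec (ovsaLang ℝ) (ovsaTheory ℝ) M (ovsaStructure σ))
    (τ : A ≃ₗ[ℝ] A) (hτ : StrictMono τ) (g : M →ₗ[ℝ] A) (hg : StrictMono g)
    (h : ∀ x, g (σ x) = τ (g x)) (f : ℝ[X]) {d : M} (hc : ∃ c, sigmaMap τ f c = g d) :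
    ∃ c, sigmaMap σ f c = d := by
  let _ := ovsaStructure σ
  let _ := ovsaStructure τ
  obtain ⟨s, hs⟩ := exists_term_sigmaMap.{u} (α := Fin 1 ⊕ Fin 1) f (&0)
  obtain ⟨c, hc⟩ := hc
  have key := hM.2 A (model_ovsaStructure τ hτ) (ovsaHom σ τ g hg h) 1
    (BoundedFormula.equal s (Term.var (Sum.inl 0))).ex (.ex (.equal _ _)) ![d]
  simp only [Formula.Realize, BoundedFormula.realize_ex] at key
  simp only [BoundedFormula.Realize, hs] at key
  exact key ⟨c, hc⟩

/-- Equations `f(c) = d` with `a ≤ c ≤ b` solvable in an extension are solvable in a pec model. -/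
theorem IsPec.exists_mem_Icc_sigmaMap_eq
    (hM : @IsPec (ovsaLang ℝ) (ovsaTheory ℝ) M (ovsaStructure σ))
    (τ : A ≃ₗ[ℝ] A) (hτ : StrictMono τ) (g : M →ₗ[ℝ] A) (hg : StrictMono g)
    (h : ∀ x, g (σ x) = τ (g x)) (f : ℝ[X]) {a b d : M}
    (hc : ∃ c ∈ Set.Icc (g a) (g b), sigmaMap τ f c = g d) :
    ∃ c ∈ Set.Icc a b, sigmaMap σ f c = d := by
  let _ := ovsaStructure σ
  let _ := ovsaStructure τ
  obtain ⟨s, hs⟩ := exists_term_sigmaMap.{u} (α := Fin 3 ⊕ Fin 1) f (&0)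
  obtain ⟨c, ⟨hac, hcb⟩, hc⟩ := hc
  have key := hM.2 A (model_ovsaStructure τ hτ) (ovsaHom σ τ g hg h) 3
    -- Positive formulas exclude negation, so each weak inequality is written as `<` or `=`.
    (((OVSA.ltF (Term.var (Sum.inl 0)) (&0) ⊔ BoundedFormula.equal (Term.var (Sum.inl 0)) (&0)) ⊓
      (OVSA.ltF (&0) (Term.var (Sum.inl 1)) ⊔ BoundedFormula.equal (&0) (Term.var (Sum.inl 1)))) ⊓
      BoundedFormula.equal s (Term.var (Sum.inl 2))).ex
    (.ex (.inf (.inf (.sup (.rel _ _) (.equal _ _)) (.sup (.rel _ _) (.equal _ _))) (.equal _ _)))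
    ![a, b, d]
  simp only [Formula.Realize, BoundedFormula.realize_ex, BoundedFormula.realize_inf,
    BoundedFormula.realize_sup, OVSA.realize_ltF] at key
  simp only [BoundedFormula.Realize, hs] at key
  obtain ⟨e, ⟨h1, h2⟩, h3⟩ := key ⟨c, ⟨hac.lt_or_eq, hcb.lt_or_eq⟩, hc⟩
  exact ⟨e, ⟨le_iff_lt_or_eq.2 h1, le_iff_lt_or_eq.2 h2⟩, h3⟩

end Pec

/-! ### Filling a cut in a one-dimensional extension -/

/-- The underlying space of the extension of `M` by one element. -/
def CutExtension (M : Type u) : Type u := M × ℝ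

section Cut

variable {M : Type u} [AddCommGroup M] [LinearOrder M] [IsOrderedAddMonoid M] [Module ℝ M]
  [IsStrictOrderedModule ℝ M]

/-- A filter on a linear order determines a cut if it decides every inequality with an element. -/
def IsCutFilter (F : Filter M) : Prop :=
  ∀ z, (∀ᶠ y in F, z < y) ∨ (∀ᶠ y in F, y < z)

/-- For $s\ne 0$ the sign of $m+sy$ depends only on the side of $-s^{-1}m$ on which $y$ lies, and
the filter decides that. This makes the order on $M\times\mathbb R$ total and antisymmetric. -/
theorem IsCutFilter.eventually_pos_or_neg {F : Filter M} (hF : IsCutFilter F) (p : M × ℝ)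
    (hp : p ≠ 0) : (∀ᶠ y in F, 0 < p.1 + p.2 • y) ∨ (∀ᶠ y in F, p.1 + p.2 • y < 0) := by
  obtain ⟨m, s⟩ := p
  have eq (y : M) (hs : s ≠ 0) : m + s • y = s • (y - (-(s⁻¹ • m))) := by
    rw [sub_neg_eq_add, smul_add, smul_inv_smul₀ hs, add_comm]
  rcases lt_trichotomy s 0 with hs | rfl | hs
  · rcases hF (-(s⁻¹ • m)) with h | h
    · refine .inr (h.mono fun y hy => ?_)
      rw [eq y hs.ne]
      exact smul_neg_of_neg_of_pos hs (sub_pos.2 hy)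
    · refine .inl (h.mono fun y hy => ?_)
      rw [eq y hs.ne]
      exact smul_pos_of_neg_of_neg hs (sub_neg.2 hy)
  · have : m ≠ 0 := by rintro rfl; exact hp rfl
    rcases this.lt_or_gt with h | h
    · exact .inr (.of_forall fun y => by simpa)
    · exact .inl (.of_forall fun y => by simpa)
  · rcases hF (-(s⁻¹ • m)) with h | h
    · refine .inl (h.mono fun y hy => ?_)
      rw [eq y hs.ne']
      exact smul_pos hs (sub_pos.2 hy)
    · refine .inr (h.mono fun y hy => ?_)
      rw [eq y hs.ne']
      exact smul_neg_of_pos_of_neg hs (sub_neg.2 hy)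

theorem fst_neg_add_snd_neg_smul {M : Type*} [AddCommGroup M] [Module ℝ M] (p : M × ℝ) (y : M) :
    (-p).1 + (-p).2 • y = -(p.1 + p.2 • y) := by
  rw [neg_add, Prod.fst_neg, Prod.snd_neg, neg_smul]

/-- The positive cone on `M × ℝ` for which `(0, 1)` realizes the cut determined by `F`. -/
def IsCutFilter.cone {F : Filter M} [F.NeBot] (hF : IsCutFilter F) : AddGroupCone (M × ℝ) where
  carrier := {p | ∀ᶠ y in F, 0 ≤ p.1 + p.2 • y}
  zero_mem' := .of_forall fun y => by simp
  add_mem' := fun {p q} hp hq => by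
    filter_upwards [hp, hq] with y h1 h2
    have := add_nonneg h1 h2
    rwa [add_add_add_comm, ← add_smul] at this
  eq_zero_of_mem_of_neg_mem' := fun {p} hp hq => by
    by_contra h
    have key : ∀ᶠ y in F, p.1 + p.2 • y = 0 := by
      filter_upwards [hp, hq] with y h1 h2
      refine le_antisymm ?_ h1
      rw [fst_neg_add_snd_neg_smul] at h2
      exact neg_nonneg.1 h2
    rcases hF.eventually_pos_or_neg p h with h' | h'
    · obtain ⟨y, h1, h2⟩ := (key.and h').exists
      exact h2.ne' h1
    · obtain ⟨y, h1, h2⟩ := (key.and h').exists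
      exact h2.ne h1

/-- The map `y ↦ σ⁻¹ (r y + d)`, whose fixed points are the solutions of `σ y = r y + d`. -/
def affineShift {M : Type*} [AddCommGroup M] [Module ℝ M] (σ : M ≃ₗ[ℝ] M) (r : ℝ) (d : M) (y : M) : M := σ.symm (r • y + d)

/-- A cut which is invariant under `y ↦ σ⁻¹ (r y + d)` is realized in some extension by a solution
of `σ x = r x + d`. -/
theorem exists_extension_of_isCutFilter {σ : M ≃ₗ[ℝ] M} (hσ : StrictMono σ) {F : Filter M}
    [F.NeBot] (hF : IsCutFilter F) {r : ℝ} (hr : 0 < r) {d : M}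
    (hinv : Filter.Tendsto (affineShift σ r d) F F) :
    ∃ (A : Type u) (_ : AddCommGroup A) (_ : LinearOrder A) (_ : IsOrderedAddMonoid A)
      (_ : Module ℝ A) (_ : IsStrictOrderedModule ℝ A) (τ : A ≃ₗ[ℝ] A) (g : M →ₗ[ℝ] A) (x : A),
      StrictMono τ ∧ StrictMono g ∧ (∀ x, g (σ x) = τ (g x)) ∧ τ x - r • x = g d ∧
      (∀ a, (∀ᶠ y in F, a ≤ y) → g a ≤ x) ∧ (∀ b, (∀ᶠ y in F, y ≤ b) → x ≤ g b) := by
  classical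
  have : HasMemOrNegMem hF.cone := ⟨fun p => by
    by_cases hp : p = 0
    · exact .inl (hp ▸ hF.cone.zero_mem')
    rcases hF.eventually_pos_or_neg p hp with h | h
    · exact .inl (h.mono fun y hy => hy.le)
    · refine .inr (h.mono fun y hy => ?_)
      rw [fst_neg_add_snd_neg_smul]
      exact neg_nonneg.2 hy.le⟩
  -- The type synonym carries the cone order without clashing with the product order on `M × ℝ`.
  let iG : AddCommGroup (CutExtension M) := inferInstanceAs (AddCommGroup (M × ℝ))
  let iM : Module ℝ (CutExtension M) := inferInstanceAs (Module ℝ (M × ℝ))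
  let iL : LinearOrder (CutExtension M) := LinearOrder.mkOfAddGroupCone (G := M × ℝ) hF.cone
  have le_iff (p q : CutExtension M) : p ≤ q ↔ ∀ᶠ y in F, 0 ≤ (q - p).1 + (q - p).2 • y := Iff.rfl
  have iO : IsOrderedAddMonoid (CutExtension M) := IsOrderedAddMonoid.mkOfCone (G := M × ℝ) hF.cone
  have smulPos (c : ℝ) (p : CutExtension M) (hc : 0 < c) (hp : 0 < p) : 0 < c • p := by
    refine lt_of_le_of_ne ?_ (smul_ne_zero hc.ne' hp.ne').symm
    have := (le_iff _ _).1 hp.le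
    refine (le_iff _ _).2 (this.mono fun y hy => ?_)
    rw [sub_zero] at hy ⊢
    have := smul_nonneg hc.le hy
    rwa [smul_add, smul_smul] at this
  have iS : IsStrictOrderedModule ℝ (CutExtension M) :=
    { smul_lt_smul_of_pos_left := by
        intro c hc a b h
        have := smulPos c (b - a) hc (sub_pos.2 h)
        rwa [smul_sub, sub_pos] at this
      smul_lt_smul_of_pos_right := by
        intro a ha c q h
        have := smulPos (q - c) a (sub_pos.2 h) ha
        rwa [sub_smul, sub_pos] at this }
  -- This is forced by $\tau|_M=\sigma$ and $\tau x=rx+d$ for $x=(0,1)$.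
  let τ : CutExtension M ≃ₗ[ℝ] CutExtension M :=
    { toFun := fun p => (σ p.1 + p.2 • d, r * p.2)
      invFun := fun p => (σ.symm (p.1 - (r⁻¹ * p.2) • d), r⁻¹ * p.2)
      map_add' := fun p q => Prod.ext
        (by
          change σ (p.1 + q.1) + (p.2 + q.2) • d = (σ p.1 + p.2 • d) + (σ q.1 + q.2 • d)
          rw [map_add, add_smul, add_add_add_comm])
        (mul_add r p.2 q.2)
      map_smul' := fun c p => Prod.ext
        (by
          change σ (c • p.1) + (c * p.2) • d = c • (σ p.1 + p.2 • d)
          rw [map_smul, mul_smul, smul_add])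
        (mul_left_comm r c p.2)
      left_inv := fun p => by
        refine Prod.ext ?_ ?_
        · simp [inv_mul_cancel_left₀ hr.ne']
        · simp [inv_mul_cancel_left₀ hr.ne']
      right_inv := fun p => by
        refine Prod.ext ?_ ?_
        · simp
        · simp [mul_inv_cancel_left₀ hr.ne'] }
  have hτ : StrictMono τ := by
    refine Monotone.strictMono_of_injective (fun p q h => ?_) τ.injective
    refine (le_iff _ _).2 ?_
    rw [← map_sub]
    -- At $y$, the element $\tau(m,s)$ takes the value $\sigma m+sd+rsy=\sigma(m+s\psi(y))$, so
    -- invariance of the filter under $\psi$ gives positivity.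
    refine (hinv.eventually ((le_iff _ _).1 h)).mono fun y hy => ?_
    have := hσ.monotone hy
    simp only [affineShift, map_zero, map_add, map_smul, LinearEquiv.apply_symm_apply] at this
    refine this.trans_eq ?_
    change _ = (σ (q - p).1 + (q - p).2 • d) + (r * (q - p).2) • y
    rw [smul_add, smul_smul, mul_comm r]
    abel
  let g : M →ₗ[ℝ] CutExtension M := LinearMap.inl ℝ M ℝ
  have hg : StrictMono g := by
    refine Monotone.strictMono_of_injective (fun a b h => ?_) LinearMap.inl_injective
    refine (le_iff _ _).2 (.of_forall fun y => ?_)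
    change 0 ≤ (b - a) + ((0 : ℝ) - 0) • y
    simpa using h
  refine ⟨_, iG, iL, iO, iM, iS, τ, g, ((0, 1) : M × ℝ), hτ, hg, fun x => ?_, ?_,
    fun a ha => ?_, fun b hb => ?_⟩
  · change (σ x, (0 : ℝ)) = (σ x + (0 : ℝ) • d, r * 0)
    simp
  · change (σ 0 + (1 : ℝ) • d - r • 0, r * 1 - r * 1) = (d, (0 : ℝ))
    simp
  · refine (le_iff _ _).2 (ha.mono fun y hy => ?_)
    change 0 ≤ (0 - a) + ((1 : ℝ) - 0) • y
    simpa using hy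
  · refine (le_iff _ _).2 (hb.mono fun y hy => ?_)
    change 0 ≤ (b - 0) + ((0 : ℝ) - 1) • y
    simpa [← sub_eq_add_neg] using hy

end Cut

/-- The limit of a strictly increasing sequence is a cut. -/
theorem isCutFilter_map_atTop {M : Type*} [LinearOrder M] {y : ℕ → M} (hy : StrictMono y) :
    IsCutFilter (Filter.map y Filter.atTop) := by
  intro z
  simp only [Filter.eventually_map]
  by_cases h : ∃ n, z ≤ y n
  · obtain ⟨n, hn⟩ := h
    exact .inl ((Filter.eventually_gt_atTop n).mono fun k hk => hn.trans_lt (hy hk))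
  · push Not at h
    exact .inr (.of_forall h)

/-! ### The factors σ - r with r > 0 -/

section Linear

open Polynomial

variable {M : Type u} [AddCommGroup M] [LinearOrder M] [IsOrderedAddMonoid M] [Module ℝ M]
  [IsStrictOrderedModule ℝ M] {σ : M ≃ₗ[ℝ] M}

theorem sigmaMap_X_sub_C {M : Type*} [AddCommGroup M] [Module ℝ M] (σ : M ≃ₗ[ℝ] M) (r : ℝ)
    (x : M) : sigmaMap σ (X - C r) x = σ x - r • x := by
  simp [sigmaMap_eq_aeval]

theorem affineShift_strictMono (hσ : StrictMono σ) {r : ℝ} (hr : 0 < r) (d : M) :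
    StrictMono (affineShift σ r d) := by
  intro x y h
  rw [← hσ.lt_iff_lt]
  simp only [affineShift, LinearEquiv.apply_symm_apply]
  gcongr

/-- Together with strict monotonicity this makes $\psi$ an order automorphism: it fixes the cut at
$+\infty$ and can be iterated backwards. -/
theorem affineShift_surjective {M : Type*} [AddCommGroup M] [Module ℝ M] (σ : M ≃ₗ[ℝ] M) {r : ℝ} (hr : 0 < r) (d : M) :
    Function.Surjective (affineShift σ r d) :=
  fun z => ⟨r⁻¹ • (σ z - d), by simp [affineShift, hr.ne']⟩

variable (hσ : StrictMono σ) (hM : @IsPec (ovsaLang ℝ) (ovsaTheory ℝ) M (ovsaStructure σ))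
include hσ hM

/-- The cut at $+\infty$ is invariant under $\psi$, so an infinitely large solution can be adjoined.
The trivial space is set apart because `atTop` is not a cut filter there. -/
theorem IsPec.surjective_sigmaMap_X_sub_C {r : ℝ} (hr : 0 < r) :
    Function.Surjective (sigmaMap σ (X - C r)) := by
  intro d
  rcases subsingleton_or_nontrivial M with h | h
  · exact ⟨0, Subsingleton.elim _ _⟩
  have hF : IsCutFilter (Filter.atTop : Filter M) := fun z => .inl (Filter.eventually_gt_atTop z)
  have ht : Filter.Tendsto (affineShift σ r d) Filter.atTop Filter.atTop :=
    ((affineShift_strictMono hσ hr d).orderIsoOfSurjective _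
      (affineShift_surjective σ hr d)).tendsto_atTop
  obtain ⟨A, _, _, _, _, _, τ, g, x, hτ, hg, h, hx, -⟩ :=
    exists_extension_of_isCutFilter hσ hF hr ht
  exact hM.exists_sigmaMap_eq τ hτ g hg h _ ⟨x, by rw [sigmaMap_X_sub_C, hx]⟩

/-- A strictly increasing bounded sequence whose limit is invariant under `y ↦ σ⁻¹ (r y + d)`
yields a solution of `σ c = r c + d`. -/
theorem IsPec.exists_of_sequence {r : ℝ} (hr : 0 < r) {a b d : M} {y : ℕ → M} (hy : StrictMono y)
    (hay : ∀ n, a ≤ y n) (hyb : ∀ n, y n ≤ b)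
    (hinv : Filter.Tendsto (affineShift σ r d) (Filter.map y Filter.atTop)
      (Filter.map y Filter.atTop)) :
    ∃ c ∈ Set.Icc a b, sigmaMap σ (X - C r) c = d := by
  obtain ⟨A, _, _, _, _, _, τ, g, x, hτ, hg, h, hx, h1, h2⟩ :=
    exists_extension_of_isCutFilter hσ (isCutFilter_map_atTop hy) hr hinv
  exact hM.exists_mem_Icc_sigmaMap_eq τ hτ g hg h _
    ⟨x, ⟨h1 a (Filter.eventually_map.2 (.of_forall hay)), h2 b (Filter.eventually_map.2 (.of_forall hyb))⟩, by rw [sigmaMap_X_sub_C, hx]⟩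

/-- The sign of $\psi(x)-x$ is that of $d-f(x)$. Thus $d$ lying between $f(a)$ and $f(b)$ means that
$\psi$, or else $\psi^{-1}$, moves $a$ up and does not move $b$ up; its iterates at $a$ increase and
stay below $b$. -/
theorem IsPec.hasIVP_sigmaMap_X_sub_C {r : ℝ} (hr : 0 < r) :
    HasIVP (sigmaMap σ (X - C r)) := by
  intro a b hab d hd
  -- Excluding equality makes the iterates strictly increasing, as the limit cut requires.
  by_cases ha : sigmaMap σ (X - C r) a = d
  · exact ⟨a, ⟨le_rfl, hab⟩, ha⟩
  set ψ := affineShift σ r d with hψdef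
  have hψ : StrictMono ψ := affineShift_strictMono hσ hr d
  have lt_iff (x : M) : x < ψ x ↔ sigmaMap σ (X - C r) x < d := by
    rw [← hσ.lt_iff_lt, sigmaMap_X_sub_C, hψdef, affineShift, LinearEquiv.apply_symm_apply,
      sub_lt_iff_lt_add']
  have gt_iff (x : M) : ψ x < x ↔ d < sigmaMap σ (X - C r) x := by
    rw [← hσ.lt_iff_lt, sigmaMap_X_sub_C, hψdef, affineShift, LinearEquiv.apply_symm_apply,
      lt_sub_iff_add_lt']
  rcases Set.mem_uIcc.1 hd with ⟨h1, h2⟩ | ⟨h1, h2⟩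
  · have ha' : a < ψ a := (lt_iff a).2 (h1.lt_of_ne ha)
    have hb' : ψ b ≤ b := le_of_not_gt fun h => h2.not_gt ((lt_iff b).1 h)
    have hy : StrictMono fun n => ψ^[n] a := hψ.strictMono_iterate_of_lt_map ha'
    refine hM.exists_of_sequence hσ hr hy (fun n => hy.monotone (Nat.zero_le n)) (fun n => ?_) ?_
    · exact (hψ.monotone.iterate n hab).trans (hψ.monotone.antitone_iterate_of_map_le hb'
        (Nat.zero_le n))
    · rw [Filter.tendsto_map'_iff, Filter.tendsto_def]
      intro s hs
      refine ((Filter.tendsto_add_atTop_nat 1).eventually (Filter.mem_map.1 hs)).mono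
        fun n hn => ?_
      simpa [Function.iterate_succ_apply'] using hn
  · have ha' : ψ a < a := (gt_iff a).2 (h2.lt_of_ne (Ne.symm ha))
    have hb' : b ≤ ψ b := le_of_not_gt fun h => h1.not_gt ((gt_iff b).1 h)
    let e : M ≃o M := hψ.orderIsoOfSurjective _ (affineShift_surjective σ hr d)
    have he : StrictMono e.symm := e.symm.strictMono
    have hy : StrictMono fun n => e.symm^[n] a :=
      he.strictMono_iterate_of_lt_map ((e.lt_symm_apply).2 ha')
    refine hM.exists_of_sequence hσ hr hy (fun n => hy.monotone (Nat.zero_le n)) (fun n => ?_) ?_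
    · exact (he.monotone.iterate n hab).trans (he.monotone.antitone_iterate_of_map_le
        ((e.symm_apply_le).2 hb') (Nat.zero_le n))
    · rw [Filter.tendsto_map'_iff, Filter.tendsto_def]
      intro s hs
      -- Here $\psi$ sends the term of index $n+1$ to that of index $n$, so the sequence is
      -- reindexed by one.
      rw [← Filter.eventually_mem_set, ← Filter.map_add_atTop_eq_nat 1, Filter.eventually_map]
      refine Filter.Eventually.mono (Filter.mem_map.1 hs) fun n hn => ?_
      change ψ (e.symm^[n + 1] a) ∈ s
      rw [Function.iterate_succ_apply']
      change e (e.symm _) ∈ s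
      rw [e.apply_symm_apply]
      exact hn

end Linear

/-! ### Composition, and strictly monotone factors -/

section Monotone

open Polynomial

theorem StrictMono.hasIVP_of_surjective {M : Type*} [LinearOrder M] {F : M → M}
    (hF : StrictMono F) (hs : Function.Surjective F) : HasIVP F := by
  intro a b hab d hd
  obtain ⟨c, rfl⟩ := hs d
  rw [Set.uIcc_of_le (hF.monotone hab)] at hd
  exact ⟨c, ⟨hF.le_iff_le.1 hd.1, hF.le_iff_le.1 hd.2⟩, rfl⟩

theorem StrictAnti.hasIVP_of_surjective {M : Type*} [LinearOrder M] {F : M → M}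
    (hF : StrictAnti F) (hs : Function.Surjective F) : HasIVP F := by
  intro a b hab d hd
  obtain ⟨c, rfl⟩ := hs d
  rw [Set.uIcc_of_ge (hF.antitone hab)] at hd
  exact ⟨c, ⟨hF.le_iff_ge.1 hd.2, hF.le_iff_ge.1 hd.1⟩, rfl⟩

/-- $G$ may reverse the endpoints; the unordered interval in the definition of the IVP absorbs this.
-/
theorem HasIVP.comp {M : Type*} [LinearOrder M] {F G : M → M} (hF : HasIVP F) (hG : HasIVP G) :
    HasIVP (F ∘ G) := by
  intro a b hab d hd
  have : ∃ e ∈ Set.uIcc (G a) (G b), F e = d := by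
    rcases le_total (G a) (G b) with h | h
    · rw [Set.uIcc_of_le h]
      exact hF _ _ h d hd
    · rw [Set.uIcc_of_ge h]
      exact hF _ _ h d (Set.uIcc_comm (F (G a)) _ ▸ hd)
  obtain ⟨e, he, rfl⟩ := this
  obtain ⟨c, hc, rfl⟩ := hG a b hab e he
  exact ⟨c, hc, rfl⟩

variable {M : Type u} [AddCommGroup M] [LinearOrder M] [IsOrderedAddMonoid M] [Module ℝ M]
  [IsStrictOrderedModule ℝ M] {σ : M ≃ₗ[ℝ] M}

omit [IsStrictOrderedModule ℝ M] in
theorem strictMono_sigmaMap_of_pos {f : ℝ[X]} (h : ∀ x, 0 < x → 0 < sigmaMap σ f x) :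
    StrictMono (sigmaMap σ f) := by
  intro x y hxy
  have := h _ (sub_pos.2 hxy)
  rwa [sigmaMap_eq_aeval, map_sub, sub_pos, ← sigmaMap_eq_aeval, ← sigmaMap_eq_aeval] at this

theorem sigmaMap_C {M : Type*} [AddCommGroup M] [Module ℝ M] (σ : M ≃ₗ[ℝ] M) (a : ℝ) (x : M) : sigmaMap σ (C a) x = a • x := by
  simp [sigmaMap_eq_aeval]

theorem hasIVP_sigmaMap_C (a : ℝ) :
    HasIVP (sigmaMap σ (C a)) ∧ (a ≠ 0 → Function.Surjective (sigmaMap σ (C a))) := by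
  have surj (ha : a ≠ 0) : Function.Surjective (sigmaMap σ (C a)) :=
    fun d => ⟨a⁻¹ • d, by rw [sigmaMap_C, smul_inv_smul₀ ha]⟩
  refine ⟨?_, surj⟩
  rcases lt_trichotomy a 0 with h | rfl | h
  · refine StrictAnti.hasIVP_of_surjective (fun x y hxy => ?_) (surj h.ne)
    rw [sigmaMap_C, sigmaMap_C]
    exact smul_lt_smul_of_neg_left hxy h
  · intro x y hxy d hd
    simp only [sigmaMap_C, zero_smul, Set.uIcc_self, Set.mem_singleton_iff] at hd ⊢
    exact ⟨x, ⟨le_rfl, hxy⟩, hd.symm⟩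
  · refine StrictMono.hasIVP_of_surjective (fun x y hxy => ?_) (surj h.ne')
    rw [sigmaMap_C, sigmaMap_C]
    exact smul_lt_smul_of_pos_left hxy h

/-- In a pec model, a strictly monotone `σ`-polynomial is surjective: it is itself an embedding of
the model into the model, and in the target every element of the image has a preimage. -/
theorem IsPec.surjective_of_strictMono (hσ : StrictMono σ)
    (hM : @IsPec (ovsaLang ℝ) (ovsaTheory ℝ) M (ovsaStructure σ)) {f : ℝ[X]}
    (hf : StrictMono (sigmaMap σ f)) : Function.Surjective (sigmaMap σ f) := by
  intro d
  have eq : sigmaMap σ f = aeval (σ : M →ₗ[ℝ] M) f := funext (sigmaMap_eq_aeval σ f)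
  refine hM.exists_sigmaMap_eq σ hσ (aeval (σ : M →ₗ[ℝ] M) f) (eq ▸ hf) (fun x => ?_) f
    ⟨d, congrFun eq d⟩
  -- The operator $f(\sigma)$ commutes with $\sigma$ because $fX=Xf$ in $\mathbb R[X]$.
  have := congrArg (fun p => aeval (σ : M →ₗ[ℝ] M) p x) (mul_comm f X)
  simpa using this

theorem strictMono_sigmaMap_X_sub_C (hσ : StrictMono σ) {r : ℝ} (hr : r ≤ 0) :
    StrictMono (sigmaMap σ (X - C r)) := by
  refine strictMono_sigmaMap_of_pos fun x hx => ?_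
  have h1 : 0 < σ x := by simpa using hσ hx
  have h2 : r • x ≤ 0 := smul_nonpos_of_nonpos_of_nonneg hr hx.le
  simpa [sigmaMap_eq_aeval] using h2.trans_lt h1

/-- A monic quadratic `σ`-polynomial of negative discriminant is strictly monotone. -/
theorem strictMono_sigmaMap_quadratic (hσ : StrictMono σ) {p q : ℝ} (h : p ^ 2 < 4 * q) :
    StrictMono (sigmaMap σ (X ^ 2 + C p * X + C q)) := by
  refine strictMono_sigmaMap_of_pos fun x hx => ?_
  have hux : 0 < σ x := by simpa using hσ hx
  have hq : 0 < q := by nlinarith [sq_nonneg p]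
  have eq : sigmaMap σ (X ^ 2 + C p * X + C q) x = σ (σ x) + p • σ x + q • x := by
    simp [sigmaMap_eq_aeval, pow_two]
  rw [eq]
  by_contra! hle
  -- Applying $\sigma$ to $tx\le\sigma x$ and using the assumed $\sigma^2x+p\sigma x+qx\le 0$ gives
  -- $qx\le(-p-t)\sigma x$. So the set of such $t$ is bounded by $-p$ and closed under $t\mapsto
  -- q/(-p-t)$.
  have hmem (t : ℝ) (ht : t • x ≤ σ x) : t < -p ∧ (q / (-p - t)) • x ≤ σ x := by
    have h1 : t • σ x ≤ σ (σ x) := by simpa using hσ.monotone ht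
    have h2 : q • x ≤ (-p - t) • σ x := by
      have h3 : t • σ x + p • σ x + q • x ≤ 0 := le_trans (by gcongr) hle
      rw [sub_smul, neg_smul, ← sub_nonneg]
      rw [← neg_nonneg] at h3
      refine h3.trans_eq ?_
      abel
    have h3 : 0 < -p - t := by
      by_contra! h4
      exact ((smul_pos hq hx).trans_le h2).not_ge (smul_nonpos_of_nonpos_of_nonneg h4 hux.le)
    refine ⟨by linarith, ?_⟩
    rw [div_eq_inv_mul, mul_smul]
    exact (inv_smul_le_iff_of_pos h3).2 h2
  let S : Set ℝ := {t | t • x ≤ σ x}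
  have h0 : (0 : ℝ) ∈ S := by simpa [S] using hux.le
  have hb : BddAbove S := ⟨-p, fun t ht => (hmem t ht).1.le⟩
  set r := sSup S
  have hr : 0 ≤ r := le_csSup hb h0
  set δ := r ^ 2 + p * r + q with hδ
  have hδ0 : 0 < δ := by nlinarith [sq_nonneg (2 * r + p)]
  -- Take $t>r-\delta/(r+1)$ in $S$. Then $q/(-p-t)\le r$ gives $\delta\le r(r-t)\le
  -- r\delta/(r+1)<\delta$, a contradiction; the denominator $r+1$ allows $r=0$.
  obtain ⟨t, ht, hlt⟩ := exists_lt_of_lt_csSup ⟨0, h0⟩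
    (sub_lt_self r (div_pos hδ0 (by linarith : 0 < r + 1)))
  obtain ⟨h1, h2⟩ := hmem t ht
  have h3 : q / (-p - t) ≤ r := le_csSup hb h2
  rw [div_le_iff₀ (by linarith)] at h3
  have h4 : δ / (r + 1) * r < δ := by
    rw [div_mul_eq_mul_div, div_lt_iff₀ (by linarith)]
    nlinarith
  nlinarith

end Monotone

/-! ### Irreducible real polynomials -/

section Irreducible

open Polynomial

theorem exists_eq_quadratic_of_irreducible {f : ℝ[X]} (hf : Irreducible f) :
    (∃ a r : ℝ, a ≠ 0 ∧ f = C a * (X - C r)) ∨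
      ∃ a p q : ℝ, a ≠ 0 ∧ p ^ 2 < 4 * q ∧ f = C a * (X ^ 2 + C p * X + C q) := by
  have h2 : f.natDegree ≤ 2 := hf.natDegree_le_two
  have h0 : 0 < f.natDegree := hf.natDegree_pos
  have hlc : f.leadingCoeff ≠ 0 := leadingCoeff_ne_zero.2 hf.ne_zero
  interval_cases hn : f.natDegree
  · left
    have h1 : f.coeff 1 ≠ 0 := by rwa [leadingCoeff, hn] at hlc
    refine ⟨f.coeff 1, -(f.coeff 0 / f.coeff 1), h1, ?_⟩
    conv_lhs => rw [eq_X_add_C_of_natDegree_le_one hn.le]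
    rw [mul_sub, ← C_mul, mul_neg, mul_div_cancel₀ _ h1, C_neg, sub_neg_eq_add]
  · right
    have h1 : f.coeff 2 ≠ 0 := by rwa [leadingCoeff, hn] at hlc
    have eq : f = C (f.coeff 2) *
        (X ^ 2 + C (f.coeff 1 / f.coeff 2) * X + C (f.coeff 0 / f.coeff 2)) := by
      conv_lhs => rw [eq_quadratic_of_degree_le_two (natDegree_le_iff_degree_le.1 hn.le)]
      rw [mul_add, mul_add, ← mul_assoc, ← C_mul, ← C_mul, mul_div_cancel₀ _ h1,
        mul_div_cancel₀ _ h1]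
    refine ⟨_, _, _, h1, ?_, eq⟩
    by_contra! hle
    set p := f.coeff 1 / f.coeff 2
    set q := f.coeff 0 / f.coeff 2
    -- A nonnegative discriminant would give a real root by the quadratic formula.
    refine hf.not_isRoot_of_natDegree_ne_one (by omega) (x := (-p + √(p ^ 2 - 4 * q)) / 2) ?_
    have hs := Real.sq_sqrt (sub_nonneg.2 hle)
    rw [eq, IsRoot, eval_mul]
    refine mul_eq_zero_of_right _ ?_
    simp only [eval_add, eval_mul, eval_pow, eval_X, eval_C]
    linear_combination hs / 4

end Irreducible

/-! ### Assembly over the factorization of f -/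

theorem mainTheorem1 {M : Type u} [AddCommGroup M] [LinearOrder M] [IsOrderedAddMonoid M]
    [Module ℝ M] [IsStrictOrderedModule ℝ M] (σ : M ≃ₗ[ℝ] M) (hσ : StrictMono σ)
    (hM : @IsPec (ovsaLang ℝ) (ovsaTheory ℝ) M (ovsaStructure σ)) (f : ℝ[X]) :
    HasIVP (sigmaMap σ f) ∧ (f ≠ 0 → Function.Surjective (sigmaMap σ f)) := by
  have mono {g : ℝ[X]} (hg : StrictMono (sigmaMap σ g)) :
      HasIVP (sigmaMap σ g) ∧ Function.Surjective (sigmaMap σ g) :=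
    have hs := hM.surjective_of_strictMono hσ hg
    ⟨hg.hasIVP_of_surjective hs, hs⟩
  have const {a : ℝ} (ha : a ≠ 0) :
      HasIVP (sigmaMap σ (.C a)) ∧ Function.Surjective (sigmaMap σ (.C a)) :=
    (hasIVP_sigmaMap_C a).imp_right fun h => h ha
  have mul {g h : ℝ[X]} (hg : HasIVP (sigmaMap σ g) ∧ Function.Surjective (sigmaMap σ g))
      (hh : HasIVP (sigmaMap σ h) ∧ Function.Surjective (sigmaMap σ h)) :
      HasIVP (sigmaMap σ (g * h)) ∧ Function.Surjective (sigmaMap σ (g * h)) := by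
    rw [sigmaMap_mul]
    exact ⟨hg.1.comp hh.1, hg.2.comp hh.2⟩
  have irred {g : ℝ[X]} (hg : Irreducible g) :
      HasIVP (sigmaMap σ g) ∧ Function.Surjective (sigmaMap σ g) := by
    rcases exists_eq_quadratic_of_irreducible hg with ⟨a, r, ha, rfl⟩ | ⟨a, p, q, ha, hpq, rfl⟩
    · refine mul (const ha) ?_
      rcases le_or_gt r 0 with hr | hr
      · exact mono (strictMono_sigmaMap_X_sub_C hσ hr)
      · exact ⟨hM.hasIVP_sigmaMap_X_sub_C hσ hr, hM.surjective_sigmaMap_X_sub_C hσ hr⟩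
    · exact mul (const ha) (mono (strictMono_sigmaMap_quadratic hσ hpq))
  induction f using WfDvdMonoid.induction_on_irreducible with
  | zero =>
    refine ⟨?_, fun h => absurd rfl h⟩
    simpa using (hasIVP_sigmaMap_C (σ := σ) 0).1
  | unit u hu =>
    obtain ⟨a, ha, rfl⟩ := Polynomial.isUnit_iff.1 hu
    exact (const ha.ne_zero).imp_right fun h _ => h
  | mul g i hg hi ih => exact (mul (irred hi) ⟨ih.1, ih.2 hg⟩).imp_right fun h _ => h
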